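/- Let $N\ge 0$ be an integer, $\mathbb T^N=\mathbb R^N/\mathbb Z^N$ the flat torus, $\langle\cdot,\cdot\rangle$ and $|\cdot|$ the Euclidean scalar product and norm on $\mathbb R^N$, and $|x|=\min_{k\in\mathbb Z^N}|x+k|$ the induced norm on $\mathbb T^N$. A function $H:\mathbb T^N\times\mathbb R^N\to\mathbb R$ is a *Tonelli Hamiltonian* if it is of class $C^2$, $p\mapsto H(x,p)$ is strictly convex for every $x$, $\frac{\partial^2H}{\partial p^2}(x,p)$ is positive definite for every $(x,p)$, and there are functions $\alpha,\beta:[0,\infty)\to\mathbb R$ with $\alpha(h)/h\to+\infty$ and $\beta(h)/h\to+\infty$ as $h\to+\infty$ such that $\alpha(|p|)\le H(x,p)\le\beta(|p|)$ for all $(x,p)$. Its Lagrangian is $L_H(x,q)=\sup_{p\in\mathbb R^N}\{\langle p,q\rangle-H(x,p)\}$. A function $u:\mathbb T^N\to\mathbb R\cup\{+\infty\}$ is an *admissible initial datum* if $u\ge a|\cdot|+b$ on $\mathbb T^N$ for some $a,b\in\mathbb R$. For $t>0$ and such $u$, the Lax--Oleinik semigroup is $$(S_H(t)u)(x)=\inf\Big\{u(\gamma(-t))+\int_{-t}^0L_H(\gamma(s),\dot\gamma(s))\,ds\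 :\ \gamma:[-t,0]\to\mathbb T^N\text{ absolutely continuous},\ \gamma(0)=x\Big\}.$$ **Proposition.** Let $G$ and $H$ be two Tonelli Hamiltonians on $\mathbb T^N\times\mathbb R^N$. Assume that $$S_G(s)\big(S_H(t)u\big)(x)=S_H(t)\big(S_G(s)u\big)(x)\qquad\text{for every }s,t>0\text{ and }x\in\mathbb T^N,$$ and for every admissible initial datum $u:\mathbb T^N\to\mathbb R\cup\{+\infty\}$. Then $$\langle D_xG(x,p),D_pH(x,p)\rangle-\langle D_xH(x,p),D_pG(x,p)\rangle=0\qquad\text{for all }(x,p)\in\mathbb T^N\times\mathbb R^N.$$ -/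

import Mathlib

open MeasureTheory Set Filter Topology

noncomputable section

namespace HamiltonJacobi

/-- Euclidean space `ℝ^N`. -/
abbrev Euc (N : ℕ) : Type := EuclideanSpace ℝ (Fin N)

/-- The flat torus `𝕋^N = ℝ^N / ℤ^N`. -/
abbrev Torus (N : ℕ) : Type := UnitAddTorus (Fin N)

/-- The canonical projection `ℝ^N → 𝕋^N`. -/
def proj {N : ℕ} (y : Euc N) : Torus N := fun i => (y i : UnitAddCircle)

/-- The norm on the torus induced by the Euclidean norm: `|x| = min {|y| : y ∈ ℝ^N a lift of x}`. -/
def torusNorm {N : ℕ} (x : Torus N) : ℝ := sInf {r : ℝ | ∃ y : Euc N, proj y = x ∧ r = ‖y‖}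

/-- A function `g : [0,∞) → ℝ` is superlinear if `g h / h → +∞` as `h → +∞`.
(Values of `g` at negative numbers play no role.) -/
def Superlinear (g : ℝ → ℝ) : Prop := Tendsto (fun h => g h / h) atTop atTop

/-- Tonelli Hamiltonians on `𝕋^N × ℝ^N`. -/
structure IsTonelli {N : ℕ} (H : Torus N → Euc N → ℝ) : Prop where
  /-- `H` is continuous. -/
  continuous : Continuous fun z : Torus N × Euc N => H z.1 z.2
  /-- `H` is strictly convex in the momentum. -/
  strictConvex : ∀ x, StrictConvexOn ℝ univ (H x)
  /-- `H` lies between two superlinear functions of `|p|`. -/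
  superlinear : ∃ α β : ℝ → ℝ, Superlinear α ∧ Superlinear β ∧
    ∀ x p, α ‖p‖ ≤ H x p ∧ H x p ≤ β ‖p‖
  /-- `H` is of class `C²` on `𝕋^N × ℝ^N`, that is, its lift to `ℝ^N × ℝ^N` is. -/
  contDiff : ContDiff ℝ 2 fun z : Euc N × Euc N => H (proj z.1) z.2
  /-- The second derivative of `H` in the momentum is positive definite everywhere. -/
  posDef : ∀ x p v, v ≠ 0 → 0 < fderiv ℝ (fderiv ℝ (H x)) p v v

/-- The Lagrangian `L(x,q) = sup_p (⟨p,q⟩ - H(x,p))`. -/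
def lagrangian {N : ℕ} (H : Torus N → Euc N → ℝ) (x : Torus N) (q : Euc N) : ℝ :=
  ⨆ p : Euc N, (inner ℝ p q - H x p)

open Classical in
/-- The action `∫_{-t}^0 L(γ, γ') ds ∈ ℝ ∪ {+∞}` of the curve in the torus whose lift to `ℝ^N`
is `γ`. For absolutely continuous `γ` and Tonelli `H` the integrand is measurable and bounded
below, so the integral is `+∞` exactly when the integrand is not integrable. -/
def action {N : ℕ} (H : Torus N → Euc N → ℝ) (t : ℝ) (γ : ℝ → Euc N) : EReal :=
  if IntervalIntegrable (fun s => lagrangian H (proj (γ s)) (deriv γ s)) volume (-t) 0 then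
    ((∫ s in (-t)..0, lagrangian H (proj (γ s)) (deriv γ s) : ℝ) : EReal)
  else ⊤

/-- The Lax--Oleinik semigroup
`(S_H(t) u)(x) = inf { u(γ(-t)) + ∫_{-t}^0 L(γ, γ') ds : γ ∈ W^{1,1}([-t,0]; 𝕋^N), γ(0) = x }`.
The absolutely continuous curves in the torus are exactly the projections of the absolutely
continuous curves in `ℝ^N`, and the velocity of a curve is the derivative of any of its lifts. -/
def laxOleinik {N : ℕ} (H : Torus N → Euc N → ℝ) (t : ℝ) (u : Torus N → EReal) (x : Torus N) :
    EReal :=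
  ⨅ (γ : ℝ → Euc N) (_ : AbsolutelyContinuousOnInterval γ (-t) 0) (_ : proj (γ 0) = x),
    u (proj (γ (-t))) + action H t γ

/-- Admissible initial data: functions `u : 𝕋^N → ℝ ∪ {+∞}` with `u ≥ a |·| + b` for some real
`a`, `b`. -/
def IsAdmissible {N : ℕ} (u : Torus N → EReal) : Prop :=
  ∃ a b : ℝ, ∀ x, ((a * torusNorm x + b : ℝ) : EReal) ≤ u x

/-- The partial gradient `D_x H(x,p)`, with a neighbourhood of `x` in the torus parametrized by
`v ↦ x + v`. -/
def gradX {N : ℕ} (H : Torus N → Euc N → ℝ) (x : Torus N) (p : Euc N) : Euc N :=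
  gradient (fun v : Euc N => H (x + proj v) p) 0

/-- The partial gradient `D_p H(x,p)`. -/
def gradP {N : ℕ} (H : Torus N → Euc N → ℝ) (x : Torus N) (p : Euc N) : Euc N :=
  gradient (H x) p

end HamiltonJacobi

end

/-!
Fix a momentum `p` at `x`, and let `u` be `0` at the point `x - ε (D_pG + D_pH)(x,p)` and `+∞`
elsewhere. Then `S_H(ε) S_G(ε) u (x)` is the minimal action from that point to `x` when one moves
first with `G` and then with `H`, each for a time `ε`. Up to `o(ε²)`, the only part of it that
depends on the order of the two legs is `ε² ⟨D_xG, D_pH⟩(x,p)`, so commutation forces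
`⟨D_xG, D_pH⟩ = ⟨D_xH, D_pG⟩`.

The upper bound for the minimal action comes from straight segments with velocities `D_pG(x,p)` and
`D_pH(x,p)`, the Lagrangian being expanded by the envelope principle. For the lower bound, the
Fenchel inequality `⟨P, γ'⟩ ≤ L(γ, γ') + H(γ, P)` is integrated along an arbitrary competitor `γ`,
with `P` the affine momentum that solves Hamilton's equation `P' = -D_xH(x,p)` frozen at `(x,p)`;
coercivity keeps the competitors that matter within `O(ε)` of `x`.
-/

namespace HamiltonJacobi

open scoped RealInnerProductSpace

lemma integral_sub_mul_const (A k t : ℝ) :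
    ∫ s in (-t)..0, (A - s * k) = t * A + t ^ 2 / 2 * k := by
  rw [intervalIntegral.integral_sub intervalIntegrable_const
    (Continuous.intervalIntegrable (by fun_prop) _ _), intervalIntegral.integral_const,
    intervalIntegral.integral_mul_const, integral_id, smul_eq_mul]
  ring

lemma eventually_mul_lt (a : ℝ) {r : ℝ} (hr : 0 < r) : ∀ᶠ ε in 𝓝[>] (0 : ℝ), a * ε < r :=
  (Continuous.tendsto' (by fun_prop) 0 0 (mul_zero a)).mono_left nhdsWithin_le_nhds
    |>.eventually_lt_const hr

section AbsolutelyContinuous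

variable {X Y : Type*} [PseudoMetricSpace X] [PseudoMetricSpace Y] {ι : Type*} [Fintype ι] {a b : ℝ}

lemma absolutelyContinuousOnInterval_lipschitzWith_comp {f : ℝ → X} {φ : X → Y} {K : NNReal}
    (hφ : LipschitzWith K φ) (hf : AbsolutelyContinuousOnInterval f a b) :
    AbsolutelyContinuousOnInterval (fun s => φ (f s)) a b := by
  refine squeeze_zero (fun E => Finset.sum_nonneg fun i _ => dist_nonneg) (fun E => ?_)
    (by simpa using Tendsto.const_mul (K : ℝ) hf)
  rw [Finset.mul_sum]
  exact Finset.sum_le_sum fun i _ => hφ.dist_le_mul _ _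

lemma absolutelyContinuousOnInterval_inner {f g : ℝ → EuclideanSpace ℝ ι}
    (hf : AbsolutelyContinuousOnInterval f a b) (hg : AbsolutelyContinuousOnInterval g a b) :
    AbsolutelyContinuousOnInterval (fun s => ⟪f s, g s⟫) a b := by
  have hcoord (i : ι) {h : ℝ → EuclideanSpace ℝ ι} (hh : AbsolutelyContinuousOnInterval h a b) :
      AbsolutelyContinuousOnInterval (fun s => h s i) a b :=
    absolutelyContinuousOnInterval_lipschitzWith_comp (EuclideanSpace.proj (𝕜 := ℝ) i).lipschitz hh
  have hsum : (fun s => ⟪f s, g s⟫) = ∑ i, fun s => g s i * f s i := by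
    ext s
    simp [PiLp.inner_apply]
  rw [hsum]
  exact Finset.sum_induction _ (AbsolutelyContinuousOnInterval · a b) (fun _ _ => .add)
    (LipschitzWith.const (0 : ℝ)).lipschitzOnWith.absolutelyContinuousOnInterval
    fun i _ => (hcoord i hg).fun_mul (hcoord i hf)

lemma ae_differentiableAt_of_absolutelyContinuousOnInterval {E : Type*} [NormedAddCommGroup E]
    [NormedSpace ℝ E] [FiniteDimensional ℝ E] {f : ℝ → E} (hab : a ≤ b)
    (hf : AbsolutelyContinuousOnInterval f a b) :
    ∀ᵐ s ∂volume.restrict (Icc a b), DifferentiableAt ℝ f s := by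
  rw [ae_restrict_iff' measurableSet_Icc, ← uIcc_of_le hab]
  exact hf.boundedVariationOn.ae_differentiableAt_of_mem_uIcc

end AbsolutelyContinuous

section StrictConvex

variable {E : Type*} [NormedAddCommGroup E] [InnerProductSpace ℝ E] [CompleteSpace E]
  {f : E → ℝ} {g p : E}

lemma add_inner_le_of_convexOn_of_hasGradientAt (hf : ConvexOn ℝ univ f)
    (hg : HasGradientAt f g p) (q : E) : f p + ⟪g, q - p⟫ ≤ f q := by
  have hline : ConvexOn ℝ univ (f ∘ AffineMap.lineMap (k := ℝ) p q) :=
    hf.comp_affineMap (AffineMap.lineMap p q)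
  have hderiv : HasDerivAt (f ∘ AffineMap.lineMap (k := ℝ) p q) ⟪g, q - p⟫ 0 := by
    have hfd : HasFDerivAt f (InnerProductSpace.toDual ℝ E g)
        (AffineMap.lineMap p q (0 : ℝ)) := by
      simpa only [AffineMap.lineMap_apply_zero] using hg.hasFDerivAt
    simpa only [InnerProductSpace.toDual_apply_apply] using
      hfd.comp_hasDerivAt (0 : ℝ) AffineMap.hasDerivAt_lineMap
  have hslope := hline.le_slope_of_hasDerivAt (mem_univ 0) (mem_univ 1) one_pos hderiv
  simp only [slope_def_field, Function.comp_apply, AffineMap.lineMap_apply_zero,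
    AffineMap.lineMap_apply_one, sub_zero, div_one] at hslope
  linarith

lemma add_inner_lt_of_strictConvexOn_of_hasGradientAt (hf : StrictConvexOn ℝ univ f)
    (hg : HasGradientAt f g p) {q : E} (hpq : q ≠ p) : f p + ⟪g, q - p⟫ < f q := by
  have hmid := hf.2 (mem_univ p) (mem_univ q) hpq.symm one_half_pos one_half_pos (add_halves 1)
  have htangent := add_inner_le_of_convexOn_of_hasGradientAt hf.convexOn hg
    ((1 / 2 : ℝ) • p + (1 / 2 : ℝ) • q)
  have hdir : (1 / 2 : ℝ) • p + (1 / 2 : ℝ) • q - p = (1 / 2 : ℝ) • (q - p) := by module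
  rw [hdir, real_inner_smul_right] at htangent
  simp only [smul_eq_mul] at hmid
  linarith

end StrictConvex

variable {N : ℕ}

lemma proj_add (y z : Euc N) : proj (y + z) = proj y + proj z := by
  ext i; simp [proj]

lemma proj_sub (y z : Euc N) : proj (y - z) = proj y - proj z := by
  ext i; simp [proj]

lemma isOpenQuotientMap_proj : IsOpenQuotientMap (proj : Euc N → Torus N) :=
  (IsOpenQuotientMap.piMap fun _ : Fin N => QuotientAddGroup.isOpenQuotientMap_mk).comp
    (EuclideanSpace.equiv (Fin N) ℝ).toHomeomorph.isOpenQuotientMap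

lemma eq_of_proj_eq_of_norm_sub_lt_one {y z : Euc N} (h : proj y = proj z) (hyz : ‖y - z‖ < 1) :
    y = z := by
  ext i
  have hcoe : ((y i - z i : ℝ) : UnitAddCircle) = 0 := by
    rw [AddCircle.coe_sub, sub_eq_zero]
    exact congrFun h i
  obtain ⟨n, hn⟩ := (AddCircle.coe_eq_zero_iff 1).1 hcoe
  have hn' : (n : ℝ) = y i - z i := by simpa using hn
  have hlt : |(n : ℝ)| < 1 := by
    rw [hn']
    exact (PiLp.norm_apply_le (y - z) i).trans_lt hyz
  have hn0 : n = 0 := Int.abs_lt_one_iff.1 (by exact_mod_cast hlt)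
  rw [hn0, Int.cast_zero] at hn'
  linarith

lemma exists_abs_le_of_norm_le {H : Torus N → Euc N → ℝ}
    (hH : Continuous fun z : Torus N × Euc N => H z.1 z.2) (A : ℝ) :
    ∃ C, ∀ x p, ‖p‖ ≤ A → |H x p| ≤ C := by
  obtain ⟨C, hC⟩ := ((isCompact_univ (X := Torus N)).prod
    (isCompact_closedBall (0 : Euc N) A)).exists_bound_of_continuousOn hH.continuousOn
  exact ⟨C, fun x p hp => hC (x, p) ⟨mem_univ _, by simpa using hp⟩⟩

/-- The integrand of `action H t γ`. -/
noncomputable abbrev lagrangianAlong (H : Torus N → Euc N → ℝ) (γ : ℝ → Euc N) (s : ℝ) : ℝ :=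
  lagrangian H (proj (γ s)) (deriv γ s)

/-- `C¹` Hamiltonians on `𝕋^N × ℝ^N` that are strictly convex in the momentum and whose Lagrangian
is finite. Finiteness keeps `lagrangian` away from the junk value of an unbounded supremum. -/
structure IsConvexHamiltonian (H : Torus N → Euc N → ℝ) : Prop where
  contDiff : ContDiff ℝ 1 fun z : Euc N × Euc N => H (proj z.1) z.2
  strictConvex : ∀ x, StrictConvexOn ℝ univ (H x)
  bddAbove : ∀ x q, BddAbove (range fun p : Euc N => ⟪p, q⟫ - H x p)

lemma IsTonelli.isConvexHamiltonian {H : Torus N → Euc N → ℝ} (hH : IsTonelli H) :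
    IsConvexHamiltonian H := by
  refine ⟨hH.contDiff.of_le one_le_two, hH.strictConvex, fun x q => ?_⟩
  obtain ⟨α, β, hα, -, hαβ⟩ := hH.superlinear
  obtain ⟨R, hR⟩ := eventually_atTop.1
    ((hα.eventually_ge_atTop ‖q‖).and (eventually_gt_atTop 0))
  obtain ⟨C, hC⟩ := exists_abs_le_of_norm_le hH.continuous R
  refine ⟨max 0 (R * ‖q‖ + C), forall_mem_range.2 fun p => ?_⟩
  have hpq : ⟪p, q⟫ ≤ ‖p‖ * ‖q‖ := real_inner_le_norm p q
  rcases le_total ‖p‖ R with hp | hp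
  · have hHp := (abs_le.1 (hC x p hp)).1
    have hpR : ‖p‖ * ‖q‖ ≤ R * ‖q‖ := by gcongr
    exact le_max_of_le_right (by linarith)
  · obtain ⟨hslope, hpos⟩ := hR ‖p‖ hp
    rw [le_div_iff₀ hpos] at hslope
    exact le_max_of_le_left (by linarith [(hαβ x p).1])

namespace IsConvexHamiltonian

variable {H : Torus N → Euc N → ℝ} (hH : IsConvexHamiltonian H)
include hH

lemma continuous : Continuous fun z : Torus N × Euc N => H z.1 z.2 :=
  (isOpenQuotientMap_proj.prodMap .id).continuous_comp_iff.1 hH.contDiff.continuous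

lemma inner_sub_le_lagrangian (x : Torus N) (p q : Euc N) : ⟪p, q⟫ - H x p ≤ lagrangian H x q :=
  le_ciSup (hH.bddAbove x q) p

lemma hasGradientAt_gradP (x : Torus N) (p : Euc N) : HasGradientAt (H x) (gradP H x p) p := by
  obtain ⟨y, rfl⟩ := isOpenQuotientMap_proj.surjective x
  have hpartial := ((hH.contDiff.differentiable one_ne_zero) (y, p)).comp p
    (hasFDerivAt_prodMk_right (𝕜 := ℝ) y p).differentiableAt
  exact DifferentiableAt.hasGradientAt hpartial

lemma hasGradientAt_gradX (y p : Euc N) :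
    HasGradientAt (fun z => H (proj z) p) (gradX H (proj y) p) y := by
  have hpartial := ((hH.contDiff.differentiable one_ne_zero) (y, p)).comp y
    (hasFDerivAt_prodMk_left (𝕜 := ℝ) y p).differentiableAt
  have hgradX : gradX H (proj y) p = gradient (fun z => H (proj z) p) y := by
    simp only [gradX, gradient, ← proj_add]
    rw [fderiv_comp_add_left (f := fun z => H (proj z) p), add_zero]
  rw [hgradX]
  exact DifferentiableAt.hasGradientAt hpartial

lemma fderiv_lift (y p v w : Euc N) :
    fderiv ℝ (fun z : Euc N × Euc N => H (proj z.1) z.2) (y, p) (v, w) =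
      ⟪gradX H (proj y) p, v⟫ + ⟪gradP H (proj y) p, w⟫ := by
  have hlift := (hH.contDiff.differentiable one_ne_zero (y, p)).hasFDerivAt
  have hcompX := hlift.comp y (hasFDerivAt_prodMk_left (𝕜 := ℝ) y p)
  have hcompP := hlift.comp p (hasFDerivAt_prodMk_right (𝕜 := ℝ) y p)
  have hX := (hH.hasGradientAt_gradX y p).hasFDerivAt.unique hcompX
  have hP := (hH.hasGradientAt_gradP (proj y) p).hasFDerivAt.unique hcompP
  have hXv := DFunLike.congr_fun hX v
  have hPw := DFunLike.congr_fun hP w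
  simp only [ContinuousLinearMap.comp_apply, ContinuousLinearMap.inl_apply,
    ContinuousLinearMap.inr_apply, InnerProductSpace.toDual_apply_apply] at hXv hPw
  rw [hXv, hPw, ← map_add, Prod.mk_add_mk, add_zero, zero_add]

lemma exists_abs_sub_sub_inner_sub_inner_le (x p : Euc N) {η : ℝ} (hη : 0 < η) :
    ∃ δ > 0, ∀ z q z' q' : Euc N, ‖z - x‖ ≤ δ → ‖q - p‖ ≤ δ → ‖z' - x‖ ≤ δ → ‖q' - p‖ ≤ δ →
      |H (proj z) q - H (proj z') q' - ⟪gradX H (proj x) p, z - z'⟫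
        - ⟪gradP H (proj x) p, q - q'⟫| ≤ η * (‖z - z'‖ + ‖q - q'‖) := by
  have hstrict := (hH.contDiff.contDiffAt (x := (x, p))).hasStrictFDerivAt one_ne_zero
  obtain ⟨δ, hδ, hball⟩ := Metric.nhds_basis_closedBall.eventually_iff.1
    (hstrict.isLittleO.def hη)
  refine ⟨δ, hδ, fun z q z' q' hz hq hz' hq' => ?_⟩
  have hbound := @hball ((z, q), (z', q')) (by simp [dist_eq_norm, *])
  rw [Real.norm_eq_abs, Prod.mk_sub_mk, hH.fderiv_lift, ← sub_sub] at hbound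
  refine hbound.trans ?_
  gcongr
  exact max_le (by simp) (by simp)

lemma eventually_exists_lagrangian_gradP_eq (x p : Euc N) {δ : ℝ} (hδ : 0 < δ) :
    ∀ᶠ z in 𝓝 x, ∃ q, ‖q - p‖ ≤ δ ∧ lagrangian H (proj z) (gradP H (proj x) p) =
      ⟪q, gradP H (proj x) p⟫ - H (proj z) q := by
  set V := gradP H (proj x) p with hV
  have hcont : Continuous fun w : Euc N × Euc N => ⟪w.2, V⟫ - H (proj w.1) w.2 :=
    (continuous_snd.inner continuous_const).sub hH.contDiff.continuous
  -- By strict convexity `p` beats the whole sphere for `z = x`, hence for `z` near `x`: maximizers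
  -- on the closed ball are interior, so global by concavity.
  have hsphere : ∀ᶠ z in 𝓝 x, ∀ q ∈ Metric.sphere p δ,
      ⟪q, V⟫ - H (proj z) q < ⟪p, V⟫ - H (proj z) p := by
    refine (isCompact_sphere p δ).eventually_forall_of_forall_eventually fun q hq => ?_
    refine ContinuousAt.eventually_lt hcont.continuousAt (hcont.comp (continuous_fst.prodMk
      continuous_const)).continuousAt ?_
    have htangent := add_inner_lt_of_strictConvexOn_of_hasGradientAt (hH.strictConvex _)
      (hH.hasGradientAt_gradP (proj x) p) (Metric.ne_of_mem_sphere hq hδ.ne')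
    rw [← hV, real_inner_comm, inner_sub_left] at htangent
    linarith
  filter_upwards [hsphere] with z hz
  obtain ⟨q, hq, hmax⟩ := (isCompact_closedBall p δ).exists_isMaxOn
    ⟨p, Metric.mem_closedBall_self hδ.le⟩ (hcont.comp (continuous_const.prodMk
      continuous_id) : Continuous fun q => ⟪q, V⟫ - H (proj z) q).continuousOn
  have hq_ball : q ∈ Metric.ball p δ := (Metric.mem_closedBall.1 hq).lt_of_ne fun hq_sphere =>
    (hz q hq_sphere).not_ge (hmax (Metric.mem_closedBall_self hδ.le))
  have hconcave : ConcaveOn ℝ univ fun q : Euc N => ⟪q, V⟫ - H (proj z) q :=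
    (((innerₗ (Euc N)).flip V).concaveOn convex_univ).sub (hH.strictConvex _).convexOn
  have hglobal := IsMaxOn.of_isLocalMax_of_convex_univ
    (hmax.isLocalMax (Metric.closedBall_mem_nhds_of_mem hq_ball)) hconcave
  exact ⟨q, mem_closedBall_iff_norm.1 hq,
    le_antisymm (ciSup_le hglobal) (hH.inner_sub_le_lagrangian _ _ _)⟩

lemma eventually_lagrangian_gradP_le (x p : Euc N) {η : ℝ} (hη : 0 < η) :
    ∀ᶠ z in 𝓝 x, lagrangian H (proj z) (gradP H (proj x) p) ≤
      ⟪p, gradP H (proj x) p⟫ - H (proj x) p - ⟪gradX H (proj x) p, z - x⟫ + η * ‖z - x‖ := by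
  obtain ⟨δ, hδ, hstrict⟩ := hH.exists_abs_sub_sub_inner_sub_inner_le x p hη
  filter_upwards [Metric.closedBall_mem_nhds x hδ,
    hH.eventually_exists_lagrangian_gradP_eq x p hδ] with z hz ⟨q, hq, hLq⟩
  have htangent := add_inner_le_of_convexOn_of_hasGradientAt (hH.strictConvex _).convexOn
    (hH.hasGradientAt_gradP (proj x) p) q
  have hshift := hstrict z q x q (mem_closedBall_iff_norm.1 hz) hq (by simpa using hδ.le) hq
  simp only [sub_self, inner_zero_right, norm_zero, sub_zero, add_zero] at hshift
  rw [real_inner_comm, inner_sub_left] at htangent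
  linarith [(abs_le.1 hshift).1]

lemma measurable_lagrangian_proj {γ : ℝ → Euc N} (hγ : Continuous γ) (q : Euc N) :
    Measurable fun s => lagrangian H (proj (γ s)) q := by
  refine (lowerSemicontinuous_ciSup (fun s => hH.bddAbove (proj (γ s)) q) fun p => ?_).measurable
  exact (continuous_const.sub (hH.continuous.comp
    ((isOpenQuotientMap_proj.continuous.comp hγ).prodMk continuous_const))).lowerSemicontinuous

lemma inner_sub_inner_le_integral_lagrangianAlong_add {γ P : ℝ → Euc N} {c : ℝ → ℝ} {a b : ℝ}
    (x : Euc N) (hab : a ≤ b) (hγ : AbsolutelyContinuousOnInterval γ a b)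
    (hP : AbsolutelyContinuousOnInterval P a b)
    (hL : IntervalIntegrable (lagrangianAlong H γ) volume a b)
    (hc : IntervalIntegrable c volume a b)
    (hle : ∀ s ∈ Icc a b, H (proj (γ s)) (P s) + ⟪deriv P s, γ s - x⟫ ≤ c s) :
    ⟪P b, γ b - x⟫ - ⟪P a, γ a - x⟫ ≤
      (∫ s in a..b, lagrangianAlong H γ s) + ∫ s in a..b, c s := by
  have hγx : AbsolutelyContinuousOnInterval (fun s => γ s - x) a b :=
    hγ.fun_sub (LipschitzWith.const x).lipschitzOnWith.absolutelyContinuousOnInterval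
  have hW := absolutelyContinuousOnInterval_inner hP hγx
  rw [← hW.integral_deriv_eq_sub, ← intervalIntegral.integral_add hL hc]
  refine intervalIntegral.integral_mono_ae_restrict hab hW.intervalIntegrable_deriv (hL.add hc) ?_
  filter_upwards [ae_differentiableAt_of_absolutelyContinuousOnInterval hab hγ,
    ae_differentiableAt_of_absolutelyContinuousOnInterval hab hP,
    ae_restrict_mem measurableSet_Icc] with s hγs hPs hs
  have hderiv := (hPs.hasDerivAt.inner ℝ (hγs.hasDerivAt.sub_const x)).deriv
  have hfenchel := hH.inner_sub_le_lagrangian (proj (γ s)) (P s) (deriv γ s)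
  simp only [hderiv]
  linarith [hle s hs]

lemma exists_norm_sub_le_integral_lagrangianAlong_add : ∃ C, ∀ (γ : ℝ → Euc N) (a b r : ℝ),
    AbsolutelyContinuousOnInterval γ a b → IntervalIntegrable (lagrangianAlong H γ) volume a b →
    r ∈ Icc a b → ‖γ b - γ r‖ ≤ (∫ s in a..b, lagrangianAlong H γ s) + C * (b - a) := by
  obtain ⟨C, hC⟩ := exists_abs_le_of_norm_le hH.continuous 1
  refine ⟨C, fun γ a b r hγ hL hr => ?_⟩
  have hab : a ≤ b := hr.1.trans hr.2
  have hsub : uIcc r b ⊆ uIcc a b := by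
    rw [uIcc_of_le hr.2, uIcc_of_le hab]
    exact Icc_subset_Icc_left hr.1
  set e : Euc N := ‖γ b - γ r‖⁻¹ • (γ b - γ r)
  have hnorm : ‖γ b - γ r‖ = ⟪e, γ b - 0⟫ - ⟪e, γ r - 0⟫ := by
    rw [sub_zero, sub_zero, ← inner_sub_right, real_inner_smul_left,
      real_inner_self_eq_norm_mul_norm, ← mul_assoc, inv_mul_mul_self]
  have he : ‖e‖ ≤ 1 := by
    rw [norm_smul, norm_inv, norm_norm]
    exact inv_mul_le_one
  have hpush := hH.inner_sub_inner_le_integral_lagrangianAlong_add (P := fun _ => e)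
    (c := fun _ => C) 0 hr.2 (hγ.mono hsub)
    (LipschitzWith.const e).lipschitzOnWith.absolutelyContinuousOnInterval
    (hL.mono_set hsub) intervalIntegrable_const fun s _ => by
      simpa using (le_abs_self _).trans (hC (proj (γ s)) e he)
  have hnonneg (s : ℝ) : 0 ≤ lagrangianAlong H γ s + C := by
    have hbottom := hH.inner_sub_le_lagrangian (proj (γ s)) 0 (deriv γ s)
    rw [inner_zero_left] at hbottom
    linarith [(abs_le.1 (hC (proj (γ s)) 0 (by simp))).2]
  have hextend := intervalIntegral.integral_mono_interval hr.1 hr.2 le_rfl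
    (Eventually.of_forall hnonneg) (hL.add intervalIntegrable_const)
  rw [intervalIntegral.integral_add (hL.mono_set hsub) intervalIntegrable_const,
    intervalIntegral.integral_add hL intervalIntegrable_const,
    intervalIntegral.integral_const (a := a), smul_eq_mul, mul_comm] at hextend
  linarith

lemma exists_le_integral_lagrangianAlong (x p : Euc N) {η : ℝ} (hη : 0 < η) :
    ∃ δ > 0, ∀ (R t : ℝ) (q : Euc N) (γ : ℝ → Euc N), R ≤ δ → 0 ≤ t →
      ‖q - p‖ + t * ‖gradX H (proj x) p‖ ≤ R → (∀ s ∈ Icc (-t) 0, ‖γ s - x‖ ≤ R) →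
      AbsolutelyContinuousOnInterval γ (-t) 0 →
      IntervalIntegrable (lagrangianAlong H γ) volume (-t) 0 →
      ⟪q - t • gradX H (proj x) p, γ 0 - x⟫ - ⟪q, γ (-t) - x⟫
        - t * (H (proj x) p + ⟪gradP H (proj x) p, q - p⟫)
        + t ^ 2 / 2 * ⟪gradX H (proj x) p, gradP H (proj x) p⟫ - 2 * η * R * t ≤
      ∫ s in (-t)..0, lagrangianAlong H γ s := by
  obtain ⟨δ, hδ, hstrict⟩ := hH.exists_abs_sub_sub_inner_sub_inner_le x p hη
  refine ⟨δ, hδ, fun R t q γ hRδ ht hqR hγR hγ hL => ?_⟩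
  set D := gradX H (proj x) p
  set V := gradP H (proj x) p
  set P : ℝ → Euc N := fun s => q - (s + t) • D with hP
  set c : ℝ → ℝ := fun s => H (proj x) p + ⟪V, q - p⟫ + 2 * η * R - t * ⟪D, V⟫ - s * ⟪D, V⟫ with hc
  have hderivP (s : ℝ) : deriv P s = -D := by
    simpa only [one_smul] using ((((hasDerivAt_id' s).add_const t).smul_const D).const_sub q).deriv
  have hle : ∀ s ∈ Icc (-t) 0, H (proj (γ s)) (P s) + ⟪deriv P s, γ s - x⟫ ≤ c s := by
    intro s hs
    have hPp : ‖P s - p‖ ≤ R := calc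
      ‖P s - p‖ = ‖(q - p) - (s + t) • D‖ := by rw [hP]; congr 1; module
      _ ≤ ‖q - p‖ + (s + t) * ‖D‖ := by
        refine (norm_sub_le _ _).trans_eq ?_
        rw [norm_smul, Real.norm_of_nonneg (by linarith [hs.1])]
      _ ≤ ‖q - p‖ + t * ‖D‖ := by gcongr; linarith [hs.2]
      _ ≤ R := hqR
    have hexpand := (abs_le.1 (hstrict (γ s) (P s) x p ((hγR s hs).trans hRδ) (hPp.trans hRδ)
      (by simpa using hδ.le) (by simpa using hδ.le))).2
    have hVP : ⟪V, P s - p⟫ = ⟪V, q - p⟫ - (s + t) * ⟪D, V⟫ := by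
      rw [hP, sub_right_comm, inner_sub_right, real_inner_smul_right, real_inner_comm V D]
    have hremainder : η * (‖γ s - x‖ + ‖P s - p‖) ≤ η * (R + R) := by gcongr; exact hγR s hs
    rw [hderivP, inner_neg_left]
    simp only [hc]
    linarith
  have hpush := hH.inner_sub_inner_le_integral_lagrangianAlong_add x (by linarith) hγ
    (P := P) (c := c) (ContDiffOn.absolutelyContinuousOnInterval (by fun_prop)) hL
    (Continuous.intervalIntegrable (by fun_prop) _ _) hle
  simp only [hc, integral_sub_mul_const, hP, zero_add, neg_add_cancel, zero_smul, sub_zero] at hpush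
  linarith

lemma action_segment_le_integral {z v : Euc N} {c : ℝ → ℝ} {t : ℝ} (ht : 0 ≤ t)
    (hc : Continuous c) (hle : ∀ s ∈ Icc (-t) 0, lagrangian H (proj (z + s • v)) v ≤ c s) :
    action H t (fun s => z + s • v) ≤ ((∫ s in (-t)..0, c s : ℝ) : EReal) := by
  have hγ : Continuous fun s : ℝ => z + s • v := by fun_prop
  have hspeed (s : ℝ) : deriv (fun r : ℝ => z + r • v) s = v := by
    simpa only [one_smul] using (((hasDerivAt_id' s).smul_const v).const_add z).deriv
  have hbottom : Continuous fun s : ℝ => ⟪(0 : Euc N), v⟫ - H (proj (z + s • v)) 0 :=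
    continuous_const.sub (hH.continuous.comp
      ((isOpenQuotientMap_proj.continuous.comp hγ).prodMk continuous_const))
  have hint : IntervalIntegrable (fun s => lagrangian H (proj (z + s • v)) v) volume (-t) 0 := by
    rw [intervalIntegrable_iff_integrableOn_Icc_of_le (by linarith)]
    exact integrable_of_le_of_le (hH.measurable_lagrangian_proj hγ v).aestronglyMeasurable
      (ae_of_all _ fun s => hH.inner_sub_le_lagrangian _ 0 v)
      ((ae_restrict_iff' measurableSet_Icc).2 (ae_of_all _ hle))
      hbottom.continuousOn.integrableOn_Icc hc.continuousOn.integrableOn_Icc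
  have haction : action H t (fun s => z + s • v) =
      ((∫ s in (-t)..0, lagrangian H (proj (z + s • v)) v : ℝ) : EReal) := by
    simp only [action, hspeed, hint, if_true]
  rw [haction, EReal.coe_le_coe_iff]
  exact intervalIntegral.integral_mono_on (by linarith) hint (hc.intervalIntegrable _ _) hle

lemma exists_action_segment_le (x p : Euc N) {η : ℝ} (hη : 0 < η) :
    ∃ δ > 0, ∀ (z : Euc N) (t : ℝ), 0 ≤ t → ‖z - x‖ + t * ‖gradP H (proj x) p‖ ≤ δ →
      action H t (fun s => z + s • gradP H (proj x) p) ≤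
        ((t * (⟪p, gradP H (proj x) p⟫ - H (proj x) p - ⟪gradX H (proj x) p, z - x⟫)
          + t ^ 2 / 2 * ⟪gradX H (proj x) p, gradP H (proj x) p⟫
          + η * (‖z - x‖ + t * ‖gradP H (proj x) p‖) * t : ℝ) : EReal) := by
  obtain ⟨δ, hδ, hL⟩ := Metric.nhds_basis_closedBall.eventually_iff.1
    (hH.eventually_lagrangian_gradP_le x p hη)
  refine ⟨δ, hδ, fun z t ht hzt => ?_⟩
  set D := gradX H (proj x) p
  set V := gradP H (proj x) p
  set γ : ℝ → Euc N := fun s => z + s • V with hγ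
  set c : ℝ → ℝ := fun s =>
    ⟪p, V⟫ - H (proj x) p - ⟪D, z - x⟫ + η * (‖z - x‖ + t * ‖V‖) - s * ⟪D, V⟫ with hc
  have hle : ∀ s ∈ Icc (-t) 0, lagrangian H (proj (γ s)) V ≤ c s := by
    intro s hs
    have hdist : ‖γ s - x‖ ≤ ‖z - x‖ + t * ‖V‖ := calc
      ‖γ s - x‖ = ‖(z - x) + s • V‖ := by rw [hγ]; congr 1; module
      _ ≤ ‖z - x‖ + |s| * ‖V‖ := (norm_add_le _ _).trans_eq (by rw [norm_smul, Real.norm_eq_abs])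
      _ ≤ ‖z - x‖ + t * ‖V‖ := by gcongr; exact abs_le.2 ⟨by linarith [hs.1], by linarith [hs.2]⟩
    have hDγ : ⟪D, γ s - x⟫ = ⟪D, z - x⟫ + s * ⟪D, V⟫ := by
      rw [hγ, add_sub_right_comm, inner_add_right, real_inner_smul_right]
    have hLs := hL (mem_closedBall_iff_norm.2 (hdist.trans hzt))
    have hremainder : η * ‖γ s - x‖ ≤ η * (‖z - x‖ + t * ‖V‖) := by gcongr
    simp only [hc]
    linarith
  refine (hH.action_segment_le_integral ht (by fun_prop) hle).trans_eq (congrArg _ ?_)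
  rw [hc, integral_sub_mul_const]
  ring

end IsConvexHamiltonian

lemma action_congr {H : Torus N → Euc N → ℝ} {γ γ' : ℝ → Euc N} {t : ℝ}
    (h : lagrangianAlong H γ = lagrangianAlong H γ') : action H t γ = action H t γ' := by
  unfold action lagrangianAlong at *
  rw [h]

lemma le_add_action {H : Torus N → Euc N → ℝ} {γ : ℝ → Euc N} {t m : ℝ} {w : EReal} (hw : w ≠ ⊥)
    (h : IntervalIntegrable (lagrangianAlong H γ) volume (-t) 0 →
      ((m - ∫ s in (-t)..0, lagrangianAlong H γ s : ℝ) : EReal) ≤ w) :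
    (m : EReal) ≤ w + action H t γ := by
  by_cases hint : IntervalIntegrable (lagrangianAlong H γ) volume (-t) 0
  · rw [action, if_pos hint]
    calc (m : EReal) = ((m - ∫ s in (-t)..0, lagrangianAlong H γ s : ℝ) : EReal)
          + ((∫ s in (-t)..0, lagrangianAlong H γ s : ℝ) : EReal) := by
            rw [← EReal.coe_add, sub_add_cancel]
      _ ≤ _ := by gcongr; exact h hint
  · rw [action, if_neg hint, EReal.add_top_of_ne_bot hw]
    exact le_top

lemma laxOleinik_proj_le (H : Torus N → Euc N → ℝ) (u : Torus N → EReal) {γ : ℝ → Euc N} {t : ℝ}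
    (hγ : AbsolutelyContinuousOnInterval γ (-t) 0) :
    laxOleinik H t u (proj (γ 0)) ≤ u (proj (γ (-t))) + action H t γ :=
  iInf_le_of_le γ (iInf_le_of_le hγ (iInf_le _ rfl))

lemma le_laxOleinik_proj {H : Torus N → Euc N → ℝ} {u : Torus N → EReal} {t : ℝ} {x : Euc N}
    {w : EReal} (h : ∀ γ, AbsolutelyContinuousOnInterval γ (-t) 0 → γ 0 = x →
      w ≤ u (proj (γ (-t))) + action H t γ) : w ≤ laxOleinik H t u (proj x) := by
  refine le_iInf fun γ => le_iInf₂ fun hγ hγ0 => ?_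
  have hproj (s : ℝ) : proj (γ s + (x - γ 0)) = proj (γ s) := by
    rw [proj_add, proj_sub, hγ0, sub_self, add_zero]
  have hinvariant : lagrangianAlong H (fun s => γ s + (x - γ 0)) = lagrangianAlong H γ := by
    ext s
    rw [lagrangianAlong, hproj, deriv_add_const]
  have hshift := h (fun s => γ s + (x - γ 0))
    (hγ.fun_add (LipschitzWith.const _).lipschitzOnWith.absolutelyContinuousOnInterval)
    (add_sub_cancel _ _)
  rwa [hproj, action_congr hinvariant] at hshift

open Classical in
/-- The initial datum that vanishes at `y` and is `+∞` elsewhere: `laxOleinik H t (pointDatum y) x`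
is the minimal action needed to reach `x` from `y` in time `t`. -/
noncomputable def pointDatum (y z : Torus N) : EReal := if z = y then 0 else ⊤

lemma isAdmissible_pointDatum (y : Torus N) : IsAdmissible (pointDatum y) := by
  refine ⟨0, 0, fun z => ?_⟩
  rw [pointDatum]
  split_ifs <;> simp

lemma le_laxOleinik_pointDatum {H : Torus N → Euc N → ℝ} {y : Torus N} {x : Euc N} {t m : ℝ}
    (h : ∀ γ, AbsolutelyContinuousOnInterval γ (-t) 0 →
      IntervalIntegrable (lagrangianAlong H γ) volume (-t) 0 → γ 0 = x → proj (γ (-t)) = y →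
      m ≤ ∫ s in (-t)..0, lagrangianAlong H γ s) :
    (m : EReal) ≤ laxOleinik H t (pointDatum y) (proj x) := by
  refine le_laxOleinik_proj fun γ hγ hγ0 => ?_
  by_cases hy : proj (γ (-t)) = y
  · rw [pointDatum, if_pos hy]
    exact le_add_action EReal.zero_ne_bot fun hL => by
      exact_mod_cast sub_nonpos.2 (h γ hγ hL hγ0 hy)
  · rw [pointDatum, if_neg hy]
    exact le_add_action top_ne_bot fun _ => le_top

lemma IsConvexHamiltonian.laxOleinik_pointDatum_ne_bot {H : Torus N → Euc N → ℝ}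
    (hH : IsConvexHamiltonian H) (y : Torus N) {t : ℝ} (ht : 0 ≤ t) (x : Torus N) :
    laxOleinik H t (pointDatum y) x ≠ ⊥ := by
  obtain ⟨x, rfl⟩ := isOpenQuotientMap_proj.surjective x
  obtain ⟨C, hC⟩ := hH.exists_norm_sub_le_integral_lagrangianAlong_add
  have hbound : ((-(C * t) : ℝ) : EReal) ≤ laxOleinik H t (pointDatum y) (proj x) :=
    le_laxOleinik_pointDatum fun γ hγ hL _ _ => by
      have hnonneg := (norm_nonneg _).trans (hC γ (-t) 0 0 hγ hL ⟨by linarith, le_rfl⟩)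
      linarith
  exact ((EReal.bot_lt_coe _).trans_le hbound).ne'

lemma le_laxOleinik_laxOleinik_pointDatum {G H : Torus N → Euc N → ℝ} (hG : IsConvexHamiltonian G)
    {y : Torus N} {x : Euc N} {s t m : ℝ} (hs : 0 ≤ s)
    (h : ∀ γ₁ γ₂, AbsolutelyContinuousOnInterval γ₁ (-s) 0 →
      AbsolutelyContinuousOnInterval γ₂ (-t) 0 →
      IntervalIntegrable (lagrangianAlong G γ₁) volume (-s) 0 →
      IntervalIntegrable (lagrangianAlong H γ₂) volume (-t) 0 →
      proj (γ₁ (-s)) = y → γ₁ 0 = γ₂ (-t) → γ₂ 0 = x →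
      m ≤ (∫ r in (-s)..0, lagrangianAlong G γ₁ r) + ∫ r in (-t)..0, lagrangianAlong H γ₂ r) :
    (m : EReal) ≤ laxOleinik H t (laxOleinik G s (pointDatum y)) (proj x) :=
  le_laxOleinik_proj fun γ₂ hγ₂ hγ₂x =>
    le_add_action (hG.laxOleinik_pointDatum_ne_bot y hs _) fun hL₂ =>
      le_laxOleinik_pointDatum fun γ₁ hγ₁ hL₁ hγ₁₂ hγ₁y =>
        sub_le_iff_le_add.2 (h γ₁ γ₂ hγ₁ hγ₂ hL₁ hL₂ hγ₁y hγ₁₂ hγ₂x)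

/-- The expansion to second order in `ε` of the minimal action, with momentum `p` at `x`, from
`x - ε (D_pG + D_pH)(x,p)` to `x` when one moves first with `G` and then with `H`, for a time `ε`
each. The only term that depends on the order of the two legs is the last one. -/
noncomputable def twoLegExpansion (G H : Torus N → Euc N → ℝ) (x : Torus N) (p : Euc N)
    (ε : ℝ) : ℝ :=
  ε * (⟪p, gradP G x p + gradP H x p⟫ - G x p - H x p)
    + ε ^ 2 / 2 * (⟪gradX G x p, gradP G x p⟫ + ⟪gradX H x p, gradP H x p⟫)
    + ε ^ 2 * ⟪gradX G x p, gradP H x p⟫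

lemma exists_twoLegExpansion_le_mul (G H : Torus N → Euc N → ℝ) (x : Torus N) (p : Euc N) :
    ∃ M, ∀ ε, 0 ≤ ε → ε ≤ 1 → twoLegExpansion G H x p ε ≤ M * ε := by
  set A := ⟪p, gradP G x p + gradP H x p⟫ - G x p - H x p
  set B := (⟪gradX G x p, gradP G x p⟫ + ⟪gradX H x p, gradP H x p⟫) / 2
    + ⟪gradX G x p, gradP H x p⟫ with hB
  refine ⟨A + |B|, fun ε hε hε1 => ?_⟩
  calc twoLegExpansion G H x p ε = A * ε + B * (ε * ε) := by rw [twoLegExpansion, hB]; ring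
    _ ≤ A * ε + |B| * (ε * 1) := by gcongr; exact le_abs_self B
    _ = (A + |B|) * ε := by ring

section TwoLegs

variable {G H : Torus N → Euc N → ℝ} (hG : IsConvexHamiltonian G) (hH : IsConvexHamiltonian H)
include hG hH

lemma exists_action_segment_add_action_segment_le (x p : Euc N) {η : ℝ} (hη : 0 < η) :
    ∃ δ > 0, ∀ ε, 0 ≤ ε → ε * (‖gradP G (proj x) p‖ + ‖gradP H (proj x) p‖) ≤ δ →
      action G ε (fun s => x - ε • gradP H (proj x) p + s • gradP G (proj x) p)
        + action H ε (fun s => x + s • gradP H (proj x) p) ≤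
      ((twoLegExpansion G H (proj x) p ε
        + 2 * η * (‖gradP G (proj x) p‖ + ‖gradP H (proj x) p‖) * ε ^ 2 : ℝ) : EReal) := by
  obtain ⟨δG, hδG, hactionG⟩ := hG.exists_action_segment_le x p hη
  obtain ⟨δH, hδH, hactionH⟩ := hH.exists_action_segment_le x p hη
  refine ⟨min δG δH, lt_min hδG hδH, fun ε hε hεδ => ?_⟩
  obtain ⟨hεG, hεH⟩ := le_min_iff.1 hεδ
  set VG := gradP G (proj x) p with hVG
  set VH := gradP H (proj x) p with hVH
  set D := gradX G (proj x) p with hD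
  have hdisp : x - ε • VH - x = -(ε • VH) := by abel
  have hnorm : ‖-(ε • VH)‖ = ε * ‖VH‖ := by rw [norm_neg, norm_smul, Real.norm_of_nonneg hε]
  have hfirst := hactionG (x - ε • VH) ε hε (by rw [hdisp, hnorm]; linarith)
  have hsecond := hactionH x ε hε (by
    rw [sub_self, norm_zero]; linarith [mul_nonneg hε (norm_nonneg VG)])
  refine (add_le_add hfirst hsecond).trans ?_
  rw [← EReal.coe_add, EReal.coe_le_coe_iff, hdisp, hnorm, sub_self, norm_zero, inner_zero_right,
    inner_neg_right, real_inner_smul_right, twoLegExpansion, inner_add_right, ← hVG, ← hVH, ← hD]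
  have hslack : 0 ≤ η * ‖VG‖ * ε ^ 2 := by positivity
  linarith

theorem eventually_laxOleinik_laxOleinik_pointDatum_le (x p : Euc N) {c : ℝ} (hc : 0 < c) :
    ∀ᶠ ε in 𝓝[>] (0 : ℝ), laxOleinik H ε (laxOleinik G ε (pointDatum
        (proj (x - ε • (gradP G (proj x) p + gradP H (proj x) p))))) (proj x) ≤
      ((twoLegExpansion G H (proj x) p ε + c * ε ^ 2 : ℝ) : EReal) := by
  set VG := gradP G (proj x) p
  set VH := gradP H (proj x) p
  set κ := ‖VG‖ + ‖VH‖ + 1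
  have hκ : 0 < κ := by positivity
  obtain ⟨δ, hδ, hactions⟩ := exists_action_segment_add_action_segment_le hG hH x p
    (η := c / (2 * κ)) (by positivity)
  filter_upwards [eventually_mul_lt (‖VG‖ + ‖VH‖) hδ, self_mem_nhdsWithin] with ε hεδ hε
  have hsegment (z v : Euc N) : AbsolutelyContinuousOnInterval (fun s => z + s • v) (-ε) 0 :=
    ContDiffOn.absolutelyContinuousOnInterval (by fun_prop)
  have hfirst := laxOleinik_proj_le G (pointDatum (proj (x - ε • (VG + VH))))
    (hsegment (x - ε • VH) VG)
  have hsecond := laxOleinik_proj_le H (laxOleinik G ε (pointDatum (proj (x - ε • (VG + VH)))))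
    (hsegment x VH)
  have hstart : x - ε • VH + -ε • VG = x - ε • (VG + VH) := by module
  have hcorner : x + -ε • VH = x - ε • VH := by module
  simp only [hstart, pointDatum, if_true, zero_add, zero_smul, add_zero] at hfirst
  simp only [hcorner, zero_smul, add_zero] at hsecond
  refine (hsecond.trans (add_le_add_left hfirst _)).trans
    ((hactions ε hε.le (by linarith)).trans (EReal.coe_le_coe_iff.2 ?_))
  have herror : 2 * (c / (2 * κ)) * (‖VG‖ + ‖VH‖) ≤ c := calc
    2 * (c / (2 * κ)) * (‖VG‖ + ‖VH‖) ≤ 2 * (c / (2 * κ)) * κ := by gcongr; exact (lt_add_one _).le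
    _ = c := by field_simp
  gcongr

lemma eventually_norm_sub_le_of_integral_add_integral_le (M : ℝ) :
    ∀ᶠ κ in atTop, ∀ (ε : ℝ) (γ₁ γ₂ : ℝ → Euc N), AbsolutelyContinuousOnInterval γ₁ (-ε) 0 →
      AbsolutelyContinuousOnInterval γ₂ (-ε) 0 →
      IntervalIntegrable (lagrangianAlong G γ₁) volume (-ε) 0 →
      IntervalIntegrable (lagrangianAlong H γ₂) volume (-ε) 0 → γ₁ 0 = γ₂ (-ε) →
      (∫ s in (-ε)..0, lagrangianAlong G γ₁ s) + (∫ s in (-ε)..0, lagrangianAlong H γ₂ s) ≤ M * ε →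
      ∀ s ∈ Icc (-ε) 0, ‖γ₁ s - γ₂ 0‖ ≤ κ * ε ∧ ‖γ₂ s - γ₂ 0‖ ≤ κ * ε := by
  obtain ⟨CG, hCG⟩ := hG.exists_norm_sub_le_integral_lagrangianAlong_add
  obtain ⟨CH, hCH⟩ := hH.exists_norm_sub_le_integral_lagrangianAlong_add
  filter_upwards [eventually_ge_atTop (M + CG + CH)] with κ hκ ε γ₁ γ₂ hγ₁ hγ₂ hL₁ hL₂ hcorner hM
    s hs
  have hε : -ε ≤ 0 := hs.1.trans hs.2
  have hleg₁ := hCG γ₁ (-ε) 0 s hγ₁ hL₁ hs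
  have hleg₂ := hCH γ₂ (-ε) 0 s hγ₂ hL₂ hs
  have hleg₂' := hCH γ₂ (-ε) 0 (-ε) hγ₂ hL₂ (left_mem_Icc.2 hε)
  rw [norm_sub_rev] at hleg₁ hleg₂ hleg₂'
  have htriangle := norm_sub_le_norm_sub_add_norm_sub (γ₁ s) (γ₁ 0) (γ₂ 0)
  rw [← hcorner] at hleg₂'
  have hκε : (M + CG + CH) * ε ≤ κ * ε := by gcongr; linarith
  constructor <;> linarith [norm_nonneg (γ₁ s - γ₁ 0)]

lemma exists_twoLegExpansion_le_integral_add_integral (x p : Euc N) {η : ℝ} (hη : 0 < η) :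
    ∃ δ > 0, ∀ (R ε : ℝ) (γ₁ γ₂ : ℝ → Euc N), R ≤ δ → 0 ≤ ε →
      ε * (‖gradX G (proj x) p‖ + ‖gradX H (proj x) p‖) ≤ R →
      AbsolutelyContinuousOnInterval γ₁ (-ε) 0 → AbsolutelyContinuousOnInterval γ₂ (-ε) 0 →
      IntervalIntegrable (lagrangianAlong G γ₁) volume (-ε) 0 →
      IntervalIntegrable (lagrangianAlong H γ₂) volume (-ε) 0 →
      γ₁ (-ε) = x - ε • (gradP G (proj x) p + gradP H (proj x) p) → γ₁ 0 = γ₂ (-ε) → γ₂ 0 = x →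
      (∀ s ∈ Icc (-ε) 0, ‖γ₁ s - x‖ ≤ R ∧ ‖γ₂ s - x‖ ≤ R) →
      twoLegExpansion G H (proj x) p ε - 4 * η * R * ε ≤
        (∫ s in (-ε)..0, lagrangianAlong G γ₁ s) + ∫ s in (-ε)..0, lagrangianAlong H γ₂ s := by
  obtain ⟨δG, hδG, hlegG⟩ := hG.exists_le_integral_lagrangianAlong x p hη
  obtain ⟨δH, hδH, hlegH⟩ := hH.exists_le_integral_lagrangianAlong x p hη
  refine ⟨min δG δH, lt_min hδG hδH, fun R ε γ₁ γ₂ hRδ hε hεR hγ₁ hγ₂ hL₁ hL₂ hstart hcorner hend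
    hnear => ?_⟩
  obtain ⟨hRG, hRH⟩ := le_min_iff.1 hRδ
  set DG := gradX G (proj x) p with hDG
  set DH := gradX H (proj x) p with hDH
  set VG := gradP G (proj x) p with hVG
  set VH := gradP H (proj x) p with hVH
  have hmomentum : p - ε • DG - p = -(ε • DG) := by abel
  have hdisp : x - ε • (VG + VH) - x = -(ε • (VG + VH)) := by abel
  have hfirst := hlegG R ε p γ₁ hRG hε (by
    rw [sub_self, norm_zero]; linarith [mul_nonneg hε (norm_nonneg DH)])
    (fun s hs => (hnear s hs).1) hγ₁ hL₁
  have hsecond := hlegH R ε (p - ε • DG) γ₂ hRH hε (by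
    rw [hmomentum, norm_neg, norm_smul, Real.norm_of_nonneg hε]; linarith)
    (fun s hs => (hnear s hs).2) hγ₂ hL₂
  rw [hstart, hdisp, inner_neg_right, real_inner_smul_right, sub_self, inner_zero_right]
    at hfirst
  rw [hend, sub_self, inner_zero_right, hmomentum, inner_neg_right, real_inner_smul_right,
    real_inner_comm DG, ← hcorner] at hsecond
  rw [twoLegExpansion, ← hDG, ← hDH, ← hVG, ← hVH]
  linarith

lemma eventually_twoLegExpansion_le_integral_add_integral (x p : Euc N) {c : ℝ} (hc : 0 < c) :
    ∀ᶠ ε in 𝓝[>] (0 : ℝ), ∀ γ₁ γ₂, AbsolutelyContinuousOnInterval γ₁ (-ε) 0 →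
      AbsolutelyContinuousOnInterval γ₂ (-ε) 0 →
      IntervalIntegrable (lagrangianAlong G γ₁) volume (-ε) 0 →
      IntervalIntegrable (lagrangianAlong H γ₂) volume (-ε) 0 →
      proj (γ₁ (-ε)) = proj (x - ε • (gradP G (proj x) p + gradP H (proj x) p)) →
      γ₁ 0 = γ₂ (-ε) → γ₂ 0 = x →
      twoLegExpansion G H (proj x) p ε - c * ε ^ 2 ≤
        (∫ s in (-ε)..0, lagrangianAlong G γ₁ s) + ∫ s in (-ε)..0, lagrangianAlong H γ₂ s := by
  set V := gradP G (proj x) p + gradP H (proj x) p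
  set d := ‖gradX G (proj x) p‖ + ‖gradX H (proj x) p‖
  obtain ⟨M, hM⟩ := exists_twoLegExpansion_le_mul G H (proj x) p
  obtain ⟨κ, hκ_near, hdκ, hκ⟩ := ((eventually_norm_sub_le_of_integral_add_integral_le hG hH M).and
    ((eventually_ge_atTop d).and (eventually_gt_atTop 0))).exists
  obtain ⟨δ, hδ, hlower⟩ := exists_twoLegExpansion_le_integral_add_integral hG hH x p
    (η := c / (4 * κ)) (by positivity)
  filter_upwards [eventually_mul_lt κ hδ, eventually_mul_lt (κ + ‖V‖) one_pos,
    eventually_mul_lt 1 one_pos, self_mem_nhdsWithin]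
    with ε hεδ hε_unique hε1 (hε : 0 < ε) γ₁ γ₂ hγ₁ hγ₂ hL₁ hL₂ hstart hcorner hend
  rw [one_mul] at hε1
  by_contra! hlt
  have hcheap : (∫ s in (-ε)..0, lagrangianAlong G γ₁ s)
      + (∫ s in (-ε)..0, lagrangianAlong H γ₂ s) ≤ M * ε := by
    linarith [hM ε hε.le hε1.le, mul_nonneg hc.le (sq_nonneg ε)]
  have hnear := hκ_near ε γ₁ γ₂ hγ₁ hγ₂ hL₁ hL₂ hcorner hcheap
  rw [hend] at hnear
  have hstart_lift : γ₁ (-ε) = x - ε • V := by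
    refine eq_of_proj_eq_of_norm_sub_lt_one hstart ?_
    calc ‖γ₁ (-ε) - (x - ε • V)‖ = ‖(γ₁ (-ε) - x) + ε • V‖ := by congr 1; abel
      _ ≤ κ * ε + ε * ‖V‖ := by
        refine (norm_add_le _ _).trans (add_le_add (hnear _ (by simpa using hε.le)).1 ?_)
        rw [norm_smul, Real.norm_of_nonneg hε.le]
      _ < 1 := by linarith
  have hge := hlower (κ * ε) ε γ₁ γ₂ hεδ.le hε.le (by rw [mul_comm]; gcongr) hγ₁ hγ₂ hL₁ hL₂
    hstart_lift hcorner hend hnear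
  have herror : 4 * (c / (4 * κ)) * (κ * ε) * ε = c * ε ^ 2 := by field_simp
  linarith

theorem eventually_le_laxOleinik_laxOleinik_pointDatum (x p : Euc N) {c : ℝ} (hc : 0 < c) :
    ∀ᶠ ε in 𝓝[>] (0 : ℝ), ((twoLegExpansion G H (proj x) p ε - c * ε ^ 2 : ℝ) : EReal) ≤
      laxOleinik H ε (laxOleinik G ε (pointDatum
        (proj (x - ε • (gradP G (proj x) p + gradP H (proj x) p))))) (proj x) := by
  filter_upwards [eventually_twoLegExpansion_le_integral_add_integral hG hH x p hc,
    self_mem_nhdsWithin] with ε hlower hε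
  exact le_laxOleinik_laxOleinik_pointDatum hG (le_of_lt hε) hlower

theorem inner_gradX_gradP_le_of_laxOleinik_laxOleinik_pointDatum_le
    (hle : ∀ y, ∀ t > 0, ∀ x, laxOleinik G t (laxOleinik H t (pointDatum y)) x ≤
      laxOleinik H t (laxOleinik G t (pointDatum y)) x) (x : Torus N) (p : Euc N) :
    ⟪gradX H x p, gradP G x p⟫ ≤ ⟪gradX G x p, gradP H x p⟫ := by
  obtain ⟨x, rfl⟩ := isOpenQuotientMap_proj.surjective x
  refine le_of_forall_pos_le_add fun c hc => ?_
  obtain ⟨ε, hlower, hupper, hε⟩ :=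
    ((eventually_le_laxOleinik_laxOleinik_pointDatum hH hG x p (half_pos hc)).and
      ((eventually_laxOleinik_laxOleinik_pointDatum_le hG hH x p (half_pos hc)).and
        self_mem_nhdsWithin)).exists
  rw [add_comm (gradP H _ _)] at hlower
  have hexpand := EReal.coe_le_coe_iff.1 ((hlower.trans (hle _ ε hε _)).trans hupper)
  rw [twoLegExpansion, twoLegExpansion, add_comm (gradP H _ _)] at hexpand
  refine le_of_mul_le_mul_left ?_ (pow_pos hε 2)
  linarith

end TwoLegs

end HamiltonJacobi

theorem mainTheorem7_general (N : ℕ) (G H : HamiltonJacobi.Torus N → HamiltonJacobi.Euc N → ℝ)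
    (hG : HamiltonJacobi.IsConvexHamiltonian G) (hH : HamiltonJacobi.IsConvexHamiltonian H)
    (hcomm : ∀ y : HamiltonJacobi.Torus N, ∀ t > 0, ∀ x : HamiltonJacobi.Torus N,
      HamiltonJacobi.laxOleinik G t
          (HamiltonJacobi.laxOleinik H t (HamiltonJacobi.pointDatum y)) x =
        HamiltonJacobi.laxOleinik H t
          (HamiltonJacobi.laxOleinik G t (HamiltonJacobi.pointDatum y)) x) :
    ∀ (x : HamiltonJacobi.Torus N) (p : HamiltonJacobi.Euc N),
      inner ℝ (HamiltonJacobi.gradX G x p) (HamiltonJacobi.gradP H x p) -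
        inner ℝ (HamiltonJacobi.gradX H x p) (HamiltonJacobi.gradP G x p) = 0 := fun x p =>
  sub_eq_zero.2 (le_antisymm
    (HamiltonJacobi.inner_gradX_gradP_le_of_laxOleinik_laxOleinik_pointDatum_le hH hG
      (fun y t ht x => (hcomm y t ht x).ge) x p)
    (HamiltonJacobi.inner_gradX_gradP_le_of_laxOleinik_laxOleinik_pointDatum_le hG hH
      (fun y t ht x => (hcomm y t ht x).le) x p))

theorem mainTheorem7 (N : ℕ) (G H : HamiltonJacobi.Torus N → HamiltonJacobi.Euc N → ℝ)
    (hG : HamiltonJacobi.IsTonelli G) (hH : HamiltonJacobi.IsTonelli H)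
    (hcomm : ∀ u : HamiltonJacobi.Torus N → EReal, HamiltonJacobi.IsAdmissible u →
      ∀ s t : ℝ, 0 < s → 0 < t → ∀ x : HamiltonJacobi.Torus N,
        HamiltonJacobi.laxOleinik G s (HamiltonJacobi.laxOleinik H t u) x =
          HamiltonJacobi.laxOleinik H t (HamiltonJacobi.laxOleinik G s u) x) :
    ∀ (x : HamiltonJacobi.Torus N) (p : HamiltonJacobi.Euc N),
      inner ℝ (HamiltonJacobi.gradX G x p) (HamiltonJacobi.gradP H x p) -
        inner ℝ (HamiltonJacobi.gradX H x p) (HamiltonJacobi.gradP G x p) = 0 :=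
  mainTheorem7_general N G H hG.isConvexHamiltonian hH.isConvexHamiltonian fun y t ht x =>
    hcomm _ (HamiltonJacobi.isAdmissible_pointDatum y) t t ht ht x
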